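/- Let $\mathcal M$ be a bicomplete simplicial model category that is cofibrantly generated, with set $J$ of generating trivial cofibrations. Let $C$ be a class of maps of $\mathcal M$ that is saturated (closed under retracts, pushouts and transfinite compositions) and contains $J$ (equivalently, contains all trivial cofibrations). Let $K$ be a (small) set of cofibrant objects of $\mathcal M$. A map $f$ is a \emph{$K$-colocal equivalence} if $\mathrm{map}_{\mathcal M}(A,f)$ is a weak equivalence of simplicial sets for all $A\in K$, where $\mathrm{map}_{\mathcal M}$ is the homotopy function complex. Let $R_K\mathcal M$ be the category $\mathcal M$ with the $K$-colocal equivalences as weak equivalences and the fibrations of $\mathcal M$ as fibrations (and with cofibrations the maps having the left lifting property with respect to the maps that are both), and suppose that $R_K\mathcal M$ is a cofibrantly generated model category with set of generating cofibrations $\Lambda(K)\cup J$, where $\Lambda(K)=\{A^\bullet\otimes\partial\Delta[n]\to A^\bullet\otimes\Delta[n] : A\in K,\ n\ge 0\}$ and $A^\bullet=A\otimes\Delta[\bullet]$, that is, $\Lambda(K)=\{A\otimes\partial\Delta[n]\to A\otimes\Delta[n]\}$. (1) Call an object $X$ \emph{finite relative to $C$} if $\mathcal M(X,-)$ preserves filtered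 colimits along $C$, i.e. colimits of small filtered diagrams all of whose transition maps lie in $C$. Suppose that the objects $A\otimes\Delta[n]$ ($A\in K$, $n\ge0$) and all domains and codomains of maps in $J$ are finite relative to $C$. Then the $K$-colocal equivalences are closed under filtered colimits along $C$: if $p:X\to Y$ is a natural transformation of small filtered diagrams whose transition maps all lie in $C$, and every $p_d$ is a $K$-colocal equivalence, then so is $\operatorname{colim} p$. If moreover every object of $\mathcal M$ is small relative to $C$, then $R_K\mathcal M$ is $C$-compactly generated, i.e. it is cofibrantly generated, its weak equivalences are closed under filtered colimits along $C$, and every object is small relative to $C$. (2) Suppose only that the same objects are finite relative to $C$ in the sequential sense: for each of them there is a finite cardinal $\kappa$ such that the object is $\kappa$-small relative to $C$, i.e. $\mathcal M(X,-)$ preserves the colimits of all $\lambda$-sequences of maps in $C$, for $\lambda$ a limit ordinal. Then the $K$-colocal equivalences are closed under colimits of $\lambda$-sequences of maps in $C$, for every limit ordinal $\lambda$. (3) If $\mathcal M$ is locally presentable, then every object of $\mathcal M$ is small relative to $C$. -/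

import Mathlib

open CategoryTheory Limits MonoidalCategory Simplicial HomotopicalAlgebra Opposite

universe v u

noncomputable section

namespace RightBousfield

/-! ### Weak equivalences of simplicial sets -/

/-- A map `f : S ⟶ T` of simplicial sets is a weak equivalence if, for every Kan complex `Z`,
precomposition with `f` induces a bijection `π₀ (Z ^ T) → π₀ (Z ^ S)`. -/
def SSetWeakEquivalence {S T : SSet.{v}} (f : S ⟶ T) : Prop :=
  ∀ (Z : SSet.{v}) [SSet.KanComplex Z],
    Function.Bijective (SSet.mapπ₀ ((MonoidalClosed.pre f).app Z))

/-- Kan fibrations of simplicial sets. -/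
def SSetFibration {S T : SSet.{v}} (f : S ⟶ T) : Prop :=
  SSet.modelCategoryQuillen.J.rlp f

/-! ### Simplicial model categories -/

section Simplicial

variable {M : Type u} [Category.{v} M] [SimplicialCategory M]

/-- A tensor of the object `X` with the simplicial set `S`: an object `X ⊗ S` with a unit
`S ⟶ Map(X, X ⊗ S)` such that `Map(X ⊗ S, Y) ⟶ Map(S, Map(X, Y))` is an isomorphism
for all `Y`. -/
structure SimplicialTensor (X : M) (S : SSet.{v}) where
  obj : M
  unit : S ⟶ SimplicialCategory.sHom X obj
  isIso (Y : M) : IsIso (MonoidalClosed.curry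
    (unit ▷ SimplicialCategory.sHom obj Y ≫ SimplicialCategory.sHomComp X obj Y))

attribute [instance] SimplicialTensor.isIso

/-- The morphism `X ⊗ S ⟶ Y` corresponding to a map `g : S ⟶ Map(X, Y)`. -/
def SimplicialTensor.desc {X : M} {S : SSet.{v}} (t : SimplicialTensor X S) {Y : M}
    (g : S ⟶ SimplicialCategory.sHom X Y) : t.obj ⟶ Y :=
  (eHomEquiv SSet.{v}).symm (MonoidalClosed.curry' g ≫ inv (MonoidalClosed.curry
    (t.unit ▷ SimplicialCategory.sHom t.obj Y ≫ SimplicialCategory.sHomComp X t.obj Y)))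

/-- A cotensor of the object `X` with the simplicial set `S`: an object `X ^ S` with a counit
`S ⟶ Map(X ^ S, X)` such that `Map(Y, X ^ S) ⟶ Map(S, Map(Y, X))` is an isomorphism
for all `Y`. -/
structure SimplicialCotensor (X : M) (S : SSet.{v}) where
  obj : M
  counit : S ⟶ SimplicialCategory.sHom obj X
  isIso (Y : M) : IsIso (MonoidalClosed.curry
    ((β_ S (SimplicialCategory.sHom Y obj)).hom ≫ SimplicialCategory.sHom Y obj ◁ counit ≫
      SimplicialCategory.sHomComp Y obj X))

/-- Postcomposition `Map(X, Y) ⟶ Map(X, Y')` with `g : Y ⟶ Y'`. -/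
abbrev sHomPost (X : M) {Y Y' : M} (g : Y ⟶ Y') :
    SimplicialCategory.sHom X Y ⟶ SimplicialCategory.sHom X Y' :=
  eHomWhiskerLeft SSet.{v} X g

/-- Precomposition `Map(X', Y) ⟶ Map(X, Y)` with `f : X ⟶ X'`. -/
abbrev sHomPre {X X' : M} (f : X ⟶ X') (Y : M) :
    SimplicialCategory.sHom X' Y ⟶ SimplicialCategory.sHom X Y :=
  eHomWhiskerRight SSet.{v} f Y

/-- The map `Map(B, X) ⟶ Map(A, X) ×_{Map(A, Y)} Map(B, Y)` attached to `i : A ⟶ B` and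
`p : X ⟶ Y`. -/
def pullbackHom {A B X Y : M} (i : A ⟶ B) (p : X ⟶ Y) :
    SimplicialCategory.sHom B X ⟶ pullback (sHomPost A p) (sHomPre i Y) :=
  pullback.lift (sHomPre i X) (sHomPost B p) (eHom_whisker_exchange SSet.{v} i p).symm

variable (M) in
/-- A simplicial model category: a model category enriched over simplicial sets which is
tensored and cotensored over simplicial sets (first axiom) and such that the maps `pullbackHom i p`
satisfy the usual compatibility with cofibrations, fibrations and weak equivalences. -/
class SimplicialModelCategory [ModelCategory M] where
  tensor (X : M) (S : SSet.{v}) : SimplicialTensor X S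
  cotensor (X : M) (S : SSet.{v}) : SimplicialCotensor X S
  fibration {A B X Y : M} (i : A ⟶ B) (p : X ⟶ Y) [Cofibration i] [Fibration p] :
    SSetFibration (pullbackHom i p)
  weakEquivalence {A B X Y : M} (i : A ⟶ B) (p : X ⟶ Y) [Cofibration i] [Fibration p]
    (h : WeakEquivalence i ∨ WeakEquivalence p) : SSetWeakEquivalence (pullbackHom i p)

variable [ModelCategory M] [SimplicialModelCategory M]

/-- The tensor `X ⊗ S`. -/
def sTensor (X : M) (S : SSet.{v}) : M := (SimplicialModelCategory.tensor X S).obj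

/-- The map `X ⊗ S ⟶ X ⊗ T` induced by `f : S ⟶ T`: it is the one corresponding to
`S ⟶ T ⟶ Map(X, X ⊗ T)` under `Map(X ⊗ S, X ⊗ T) ≅ Map(S, Map(X, X ⊗ T))`. -/
def sTensorMap (X : M) {S T : SSet.{v}} (f : S ⟶ T) : sTensor X S ⟶ sTensor X T :=
  (SimplicialModelCategory.tensor X S).desc (f ≫ (SimplicialModelCategory.tensor X T).unit)

/-! ### Right Bousfield localization -/

/-- `K`-colocal equivalences, for a class `K` of cofibrant objects of a simplicial model category.
For `A` cofibrant and `X ⟶ X'` a weak equivalence to a fibrant object, the simplicial set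
`Map(A, X')` is a (right) homotopy function complex `map(A, X)`: its `n`-simplices are the
morphisms from `A` to the `n`th term of the simplicial resolution `X' ^ Δ[n]` of `X`. Hence `f` is a
`K`-colocal equivalence if, for some fibrant approximation `f'` of `f` (equivalently, for any),
`Map(A, f')` is a weak equivalence for all `A` in `K`. -/
def colocalEquivalences (K : ObjectProperty M) : MorphismProperty M := fun X Y f ↦
  ∃ (X' Y' : M) (a : X ⟶ X') (b : Y ⟶ Y') (f' : X' ⟶ Y'),
    WeakEquivalence a ∧ WeakEquivalence b ∧ IsFibrant X' ∧ IsFibrant Y' ∧ a ≫ f' = f ≫ b ∧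
      ∀ A : M, K A → SSetWeakEquivalence (sHomPost A f')

/-- The cofibrations of the right Bousfield localization `R_K M`: the maps with the left lifting
property with respect to the maps which are fibrations of `M` and `K`-colocal equivalences. -/
def colocalCofibrations (K : ObjectProperty M) : MorphismProperty M :=
  (fibrations M ⊓ colocalEquivalences K).llp

/-- The set `Λ(K)` of maps `A^• ⊗ ∂Δ[n] ⟶ A^• ⊗ Δ[n]`, for `A` in `K` and `n ≥ 0`, for the
standard cosimplicial resolution `A^n = A ⊗ Δ[n]` of a cofibrant object `A`. -/
def LambdaSet (K : ObjectProperty M) : MorphismProperty M :=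
  MorphismProperty.ofHoms (fun (p : Subtype K × ℕ) ↦ sTensorMap p.1.1 (SSet.boundary p.2).ι)

end Simplicial

/-! ### Smallness and cofibrant generation -/

section Smallness

variable {M : Type u} [Category.{v} M]

/-- A saturated class: closed under retracts, pushouts and transfinite compositions. -/
structure IsSaturatedClass (C : MorphismProperty M) : Prop where
  retracts : C.IsStableUnderRetracts
  pushouts : C.IsStableUnderCobaseChange
  transfiniteCompositions : MorphismProperty.IsStableUnderTransfiniteComposition.{v} C

/-- For a well-ordered set `L` without greatest element (a limit ordinal), `F : L ⥤ M` is an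
`L`-sequence of maps in `C`: it is colimit-preserving and `F j ⟶ F (j + 1)` is in `C`
for all `j`. -/
structure IsSequenceIn (C : MorphismProperty M) {L : Type v} [LinearOrder L] [SuccOrder L]
    [OrderBot L] [WellFoundedLT L] [NoMaxOrder L] (F : L ⥤ M) : Prop where
  continuous : F.IsWellOrderContinuous
  map_succ (j : L) : C (F.map (homOfLE (Order.le_succ j)))

/-- `X` is `κ`-small relative to `C`: `Hom(X, -)` preserves the colimits of the sequences of maps
in `C` that are indexed by `κ`-filtered ordinals, i.e. limit ordinals in which every subset
of cardinality at most `κ` is bounded. -/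
def IsCardinalSmallRelativeTo (κ : Cardinal.{v}) (C : MorphismProperty M) (X : M) : Prop :=
  ∀ (L : Type v) [LinearOrder L] [SuccOrder L] [OrderBot L] [WellFoundedLT L] [NoMaxOrder L],
    (∀ s : Set L, Cardinal.mk s ≤ κ → BddAbove s) →
    ∀ F : L ⥤ M, IsSequenceIn C F → PreservesColimit F (coyoneda.obj (op X))

/-- `X` is small relative to `C`: it is `κ`-small relative to `C` for some cardinal `κ`. -/
def IsSmallRelativeTo (C : MorphismProperty M) (X : M) : Prop :=
  ∃ κ : Cardinal.{v}, IsCardinalSmallRelativeTo κ C X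

/-- `X` is sequentially finite relative to `C`: it is `κ`-small relative to `C` for some finite
cardinal `κ`. -/
def IsSequentiallyFiniteRelativeTo (C : MorphismProperty M) (X : M) : Prop :=
  ∃ k : ℕ, IsCardinalSmallRelativeTo (k : Cardinal.{v}) C X

/-- `X` is finite relative to `C`: `Hom(X, -)` preserves filtered colimits along `C`, i.e. colimits
of small filtered diagrams all of whose transition maps are in `C`. -/
def IsFiniteRelativeTo (C : MorphismProperty M) (X : M) : Prop :=
  ∀ (D : Type v) [SmallCategory D] [IsFiltered D] (F : D ⥤ M),
    (∀ ⦃d d' : D⦄ (g : d ⟶ d'), C (F.map g)) → PreservesColimit F (coyoneda.obj (op X))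

/-- `W` is closed under filtered colimits along `C`. -/
def IsClosedUnderFilteredColimitsAlong [HasColimits M] (W C : MorphismProperty M) : Prop :=
  ∀ (D : Type v) [SmallCategory D] [IsFiltered D] (F G : D ⥤ M),
    (∀ ⦃d d' : D⦄ (g : d ⟶ d'), C (F.map g)) → (∀ ⦃d d' : D⦄ (g : d ⟶ d'), C (G.map g)) →
    ∀ p : F ⟶ G, (∀ d : D, W (p.app d)) → W (colimMap p)

/-- `W` is closed under colimits of sequences of maps in `C`, indexed by limit ordinals. -/
def IsClosedUnderSequentialColimitsAlong [HasColimits M] (W C : MorphismProperty M) : Prop :=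
  ∀ (L : Type v) [LinearOrder L] [SuccOrder L] [OrderBot L] [WellFoundedLT L] [NoMaxOrder L]
    (F G : L ⥤ M), IsSequenceIn C F → IsSequenceIn C G →
    ∀ p : F ⟶ G, (∀ j : L, W (p.app j)) → W (colimMap p)

/-- Relative `I`-cell complexes: transfinite compositions of pushouts of maps in `I`. -/
def relativeCells (I : MorphismProperty M) : MorphismProperty M :=
  MorphismProperty.transfiniteCompositions.{v} I.pushouts

/-- The classes `W`, `Cof`, `Fib` of weak equivalences, cofibrations and fibrations form a model
category structure on `M`. -/
def IsModelStructure (W Cof Fib : MorphismProperty M) : Prop :=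
  ∃ h : ModelCategory M,
    h.categoryWithWeakEquivalences.weakEquivalences = W ∧
    h.categoryWithCofibrations.cofibrations = Cof ∧
    h.categoryWithFibrations.fibrations = Fib

/-- The classes `W`, `Cof`, `Fib` form a cofibrantly generated model category structure on `M` with
sets of generating cofibrations `I` and of generating trivial cofibrations `J`. -/
structure IsCofibrantlyGenerated (W Cof Fib I J : MorphismProperty M) : Prop where
  isModelStructure : IsModelStructure W Cof Fib
  isSmall_I : MorphismProperty.IsSmall.{v} I
  isSmall_J : MorphismProperty.IsSmall.{v} J
  fib_eq : Fib = J.rlp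
  trivialFib_eq : Fib ⊓ W = I.rlp
  small_I {A B : M} (i : A ⟶ B) (hi : I i) : IsSmallRelativeTo (relativeCells I) A
  small_J {A B : M} (j : A ⟶ B) (hj : J j) : IsSmallRelativeTo (relativeCells J) A

/-- The model structure `W`, `Cof`, `Fib` is `C`-compactly generated: it is cofibrantly generated,
weak equivalences are closed under filtered colimits along `C`, and every object is small
relative to `C`. -/
structure IsCompactlyGeneratedModel [HasColimits M] (W Cof Fib C : MorphismProperty M) : Prop where
  cofibrantlyGenerated : ∃ I J : MorphismProperty M, IsCofibrantlyGenerated W Cof Fib I J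
  perfect : IsClosedUnderFilteredColimitsAlong W C
  small (X : M) : IsSmallRelativeTo C X

end Smallness

end RightBousfield

end

open RightBousfield

/-! The localization $R_K\mathcal M$ has the same fibrations as $\mathcal M$, so `J.rlp.llp`
consists of colocal equivalences, and a fibration is a colocal equivalence iff it lifts against
$\Lambda(K)\cup J$. All domains and codomains of these maps are finite:
`preservesColimit_coyoneda_tensor` deduces the case of $A\otimes\partial\Delta[n]$ from that of the
$A\otimes\Delta[n]$.

Given $p:X\to Y$, the small object argument in the diagram category, run on free diagrams on maps of
`J`, factors $p$ as $\varphi:X\to Z$ followed by $q:Z\to Y$ (`exists_factorization_freeMaps`).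
Pointwise and on colimits, $\varphi$ lies in `J.rlp.llp`. On a cofinal set `N` of indices, $q$ is a
fibration, and a colocal equivalence by two-out-of-three, so it lifts against $\Lambda(K)\cup J$. By
finiteness this passes to $\operatorname{colim} q$.

Finiteness applies to $Z$ only if $Z$ is again a diagram along `C`. Its transition maps are in `C`
by a corner-map argument (`map_mem_of_llp_rlp`), valid over preorders; a filtered category is first
replaced by a directed poset. For sequences, $Z$ must also be continuous, so cells are attached only
at non-limit indices (`IsExtendedFrom.of_llp_rlp`). -/

namespace RightBousfield

/-! ### Continuity of well-ordered diagrams -/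

section Continuity

variable {M : Type u} [Category.{v} M] {L : Type v} [PartialOrder L]

lemma isWellOrderContinuous_iff (F : L ⥤ M) :
    F.IsWellOrderContinuous ↔ ∀ m : L, Order.IsSuccLimit m → ∀ (T : M)
      (t : ∀ j, j < m → (F.obj j ⟶ T)), (∀ (j k : L) (hk : k < m) (h : j ≤ k),
        F.map (homOfLE h) ≫ t k hk = t j (h.trans_lt hk)) →
      ∃! l : F.obj m ⟶ T, ∀ (j : L) (hj : j < m), F.map (homOfLE hj.le) ≫ l = t j hj := by
  constructor
  · intro _ m hm T t ht
    have hc := F.isColimitOfIsWellOrderContinuous m hm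
    let s : Cocone ((Set.principalSegIio m).monotone.functor ⋙ F) :=
      { pt := T
        ι := { app j := t j.1 j.2
               naturality j k φ :=
                (ht j.1 k.1 k.2 (leOfHom φ)).trans (Category.comp_id _).symm } }
    exact ⟨hc.desc s, fun j hj ↦ hc.fac s ⟨j, hj⟩, fun l hl ↦ hc.uniq s l fun j ↦ hl j.1 j.2⟩
  · intro h
    refine ⟨fun m hm ↦ ?_⟩
    choose d hd hd' using fun s : Cocone ((Set.principalSegIio m).monotone.functor ⋙ F) ↦
      h m hm s.pt (fun j hj ↦ s.ι.app ⟨j, hj⟩)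
        (fun j k hk hjk ↦ s.w (homOfLE hjk : (⟨j, hjk.trans_lt hk⟩ : Set.Iio m) ⟶ ⟨k, hk⟩))
    exact ⟨{
      desc s := d s
      fac s j := hd s j.1 j.2
      uniq s l hl := hd' s l fun j hj ↦ hl ⟨j, hj⟩ }⟩

end Continuity

/-! ### Saturated classes are closed under coproducts -/

section Coproducts

variable {M : Type u} [Category.{v} M]

lemma isPushout_sigmaMap {ι : Type v} [HasCoproductsOfShape ι M] {P Q : ι → M}
    (a : ∀ i, P i ⟶ Q i) (i₀ : ι) (ha : ∀ i, i ≠ i₀ → IsIso (a i)) :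
    IsPushout (Sigma.ι P i₀) (a i₀) (Limits.Sigma.map a) (Sigma.ι Q i₀) where
  w := by simp
  isColimit' := ⟨by
    classical
    refine PushoutCocone.IsColimit.mk _
      (fun s ↦ Sigma.desc fun i ↦
        if h : i = i₀ then eqToHom (by rw [h]) ≫ s.inr
        else haveI := ha i h; inv (a i) ≫ Sigma.ι P i ≫ s.inl) ?_ ?_ ?_
    · intro s
      ext i
      by_cases h : i = i₀
      · subst h
        simp [s.condition]
      · simp [h]
    · intro s
      simp
    · intro s m h₁ h₂
      ext i
      by_cases h : i = i₀
      · subst h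
        simp [h₂]
      · have := ha i h
        simp [h, ← h₁]⟩

lemma monotone_step {L : Type v} [LinearOrder L] (i : L) :
    Monotone (fun j : L ↦ if i < j then (1 : Fin 2) else 0) := by
  intro j k h
  dsimp
  split_ifs with h₁ h₂
  · rfl
  · exact (h₂ (h₁.trans_le h)).elim
  · simp
  · rfl

/-- The `L`-indexed diagram which is `A` at the elements `j ≤ i` and `B` at the elements
`j > i`, with the transition map `f : A ⟶ B`. -/
noncomputable def stepFunctor {L : Type v} [LinearOrder L] (i : L) {A B : M} (f : A ⟶ B) :
    L ⥤ M :=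
  (monotone_step i).functor ⋙ ComposableArrows.mk₁ f

section

variable {L : Type v} [LinearOrder L] (i : L) {A B : M} (f : A ⟶ B)

lemma composableArrows_map_mk₁_isIso {x y : Fin 2} (φ : x ⟶ y) (h : x = y) :
    IsIso ((ComposableArrows.mk₁ f).map φ) := by
  subst h
  obtain rfl : φ = 𝟙 _ := Subsingleton.elim _ _
  infer_instance

lemma nonempty_arrow_composableArrows_map_mk₁_iso {x y : Fin 2} (φ : x ⟶ y) (hx : x = 0)
    (hy : y = 1) : Nonempty (Arrow.mk ((ComposableArrows.mk₁ f).map φ) ≅ Arrow.mk f) := by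
  subst hx hy
  exact ⟨Iso.refl _⟩

lemma stepFunctor_map_isIso {j k : L} (φ : j ⟶ k) (h : i < j ∨ ¬ i < k) :
    IsIso ((stepFunctor i f).map φ) := by
  refine composableArrows_map_mk₁_isIso f ((monotone_step i).functor.map φ) ?_
  have := leOfHom φ
  change (if i < j then (1 : Fin 2) else 0) = if i < k then 1 else 0
  rcases h with h | h
  · simp [h, h.trans_le this]
  · rw [if_neg h, if_neg fun h' ↦ h (h'.trans_le this)]

lemma nonempty_arrow_stepFunctor_map_iso {j k : L} (φ : j ⟶ k) (hj : ¬ i < j) (hk : i < k) :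
    Nonempty (Arrow.mk ((stepFunctor i f).map φ) ≅ Arrow.mk f) :=
  nonempty_arrow_composableArrows_map_mk₁_iso f ((monotone_step i).functor.map φ) (if_neg hj) (if_pos hk)

instance stepFunctor_isWellOrderContinuous : (stepFunctor i f).IsWellOrderContinuous := by
  set F := stepFunctor i f
  rw [isWellOrderContinuous_iff]
  intro m hm T t ht
  -- The diagram is constant up to isomorphism on $[k,m]$: the only jump, just after $i$, occurs
  -- before $k$ or not before $m$. Hence its value at $m$ is the colimit of the earlier ones.
  obtain ⟨k, hk, hk'⟩ : ∃ k, k < m ∧ (i < k ∨ ¬ i < m) := by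
    by_cases h : i < m
    · obtain ⟨k, h₁, h₂⟩ := (not_covBy_iff h).1 (hm.2 i)
      exact ⟨k, h₂, Or.inl h₁⟩
    · obtain ⟨k, hk⟩ := not_isMin_iff.1 hm.1
      exact ⟨k, hk, Or.inr h⟩
  have hF {x y : L} (φ : x ⟶ y) (hx : k ≤ x) (hy : y ≤ m) : IsIso (F.map φ) :=
    stepFunctor_map_isIso i f φ
      (hk'.imp (fun h ↦ h.trans_le hx) (fun h h' ↦ h (h'.trans_le hy)))
  have : IsIso (F.map (homOfLE hk.le : k ⟶ m)) := hF (homOfLE hk.le) le_rfl le_rfl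
  let r : F.obj m ⟶ F.obj k := inv (F.map (homOfLE hk.le))
  have hr : F.map (homOfLE hk.le) ≫ r = 𝟙 _ := IsIso.hom_inv_id _
  have hr' : r ≫ F.map (homOfLE hk.le) = 𝟙 _ := IsIso.inv_hom_id _
  refine ⟨r ≫ t k hk, fun j hj ↦ ?_, fun l hl ↦ ?_⟩
  · rcases le_total j k with h | h
    · have h₁ : F.map (homOfLE hj.le) = F.map (homOfLE h) ≫ F.map (homOfLE hk.le) := by
        rw [← F.map_comp]; rfl
      rw [h₁, Category.assoc, reassoc_of% hr, ht]
    · have h₁ : F.map (homOfLE hk.le) = F.map (homOfLE h) ≫ F.map (homOfLE hj.le) := by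
        rw [← F.map_comp]; rfl
      have := hF (homOfLE h) le_rfl hj.le
      rw [← cancel_epi (F.map (homOfLE h)), ← Category.assoc, ← h₁, reassoc_of% hr, ht]
  · rw [← hl k hk, reassoc_of% hr']

end

/-- The pointwise coproduct of a family of functors. -/
@[simps]
noncomputable def sigmaFunctor {ι : Type v} [HasCoproductsOfShape ι M]
    {L : Type v} [Category.{v} L] (G : ι → L ⥤ M) : L ⥤ M where
  obj j := ∐ fun i ↦ (G i).obj j
  map φ := Limits.Sigma.map fun i ↦ (G i).map φ

section

variable {ι : Type v} [HasCoproductsOfShape ι M] {L : Type v} [Category.{v} L] (G : ι → L ⥤ M)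

/-- The inclusions in the pointwise coproduct. -/
noncomputable def sigmaFunctorι (i : ι) : G i ⟶ sigmaFunctor G where
  app j := Sigma.ι (fun i ↦ (G i).obj j) i
  naturality _ _ φ := (Sigma.ι_map (fun i ↦ (G i).map φ) i).symm

variable {G}

lemma sigmaFunctor_hom_ext {j : L} {T : M} {a b : (sigmaFunctor G).obj j ⟶ T}
    (h : ∀ i, (sigmaFunctorι G i).app j ≫ a = (sigmaFunctorι G i).app j ≫ b) : a = b :=
  Sigma.hom_ext (f := fun i ↦ (G i).obj j) a b h

/-- Morphisms from a value of the pointwise coproduct. -/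
noncomputable def sigmaFunctorDesc {j : L} {T : M} (a : ∀ i, (G i).obj j ⟶ T) :
    (sigmaFunctor G).obj j ⟶ T := Sigma.desc a

lemma ι_sigmaFunctorDesc {j : L} {T : M} (a : ∀ i, (G i).obj j ⟶ T) (i : ι) :
    (sigmaFunctorι G i).app j ≫ sigmaFunctorDesc a = a i :=
  Sigma.ι_desc (f := fun i ↦ (G i).obj j) a i

end

instance sigmaFunctor_isWellOrderContinuous {ι : Type v} [HasCoproductsOfShape ι M]
    {L : Type v} [PartialOrder L] (G : ι → L ⥤ M) [∀ i, (G i).IsWellOrderContinuous] :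
    (sigmaFunctor G).IsWellOrderContinuous := by
  rw [isWellOrderContinuous_iff]
  intro m hm T t ht
  choose d hd hd' using fun i ↦ (isWellOrderContinuous_iff (G i)).1 inferInstance m hm T
    (fun j hj ↦ (sigmaFunctorι G i).app j ≫ t j hj)
    (fun j k hk h ↦ by rw [← ht j k hk h, NatTrans.naturality_assoc])
  refine ⟨sigmaFunctorDesc d, fun j hj ↦ sigmaFunctor_hom_ext fun i ↦ ?_,
    fun l hl ↦ sigmaFunctor_hom_ext fun i ↦ ?_⟩
  · rw [← NatTrans.naturality_assoc, ι_sigmaFunctorDesc]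
    exact hd i j hj
  · rw [ι_sigmaFunctorDesc]
    refine hd' i _ fun j hj ↦ ?_
    rw [NatTrans.naturality_assoc, hl j hj]

lemma nonempty_arrow_sigmaMap_iso {ι : Type v} [HasCoproductsOfShape ι M] {A B P Q : ι → M}
    (a : ∀ i, A i ⟶ B i) (b : ∀ i, P i ⟶ Q i) (e : ∀ i, Arrow.mk (a i) ≅ Arrow.mk (b i)) :
    Nonempty (Arrow.mk (Limits.Sigma.map a) ≅ Arrow.mk (Limits.Sigma.map b)) := by
  let l (i : ι) : A i ≅ P i := Arrow.leftFunc.mapIso (e i)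
  let r (i : ι) : B i ≅ Q i := Arrow.rightFunc.mapIso (e i)
  have h (i : ι) : (l i).hom ≫ b i = a i ≫ (r i).hom := (e i).hom.w
  clear_value l r
  refine ⟨Arrow.isoMk (Sigma.mapIso l) (Sigma.mapIso r) ?_⟩
  change (Sigma.mapIso l).hom ≫ Limits.Sigma.map b = Limits.Sigma.map a ≫ (Sigma.mapIso r).hom
  ext i
  simp [reassoc_of% h]

/-- Well-order the index set and replace the summands $A_i$ by $B_i$ one at a time: the step from
$i$ to its successor is a pushout of $f_i$. The added top element is the stage where every summand
has been replaced. -/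
lemma sigmaMap_mem_of_isSaturatedClass {C : MorphismProperty M} (hC : IsSaturatedClass C)
    {ι : Type v} [HasCoproductsOfShape ι M] {A B : ι → M} (f : ∀ i, A i ⟶ B i)
    (hf : ∀ i, C (f i)) : C (Limits.Sigma.map f) := by
  have := hC.retracts
  have := hC.pushouts
  have := hC.transfiniteCompositions
  obtain ⟨_, _⟩ := exists_wellFoundedLT ι
  let : OrderBot (WithTop ι) := WellFoundedLT.toOrderBot _
  let : SuccOrder (WithTop ι) := SuccOrder.ofLinearWellFoundedLT _
  let G (i : ι) : WithTop ι ⥤ M := stepFunctor (i : WithTop ι) (f i)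
  let F := sigmaFunctor G
  have hF : C (F.map (homOfLE (bot_le : ⊥ ≤ (⊤ : WithTop ι)))) := by
    refine C.transfiniteCompositionsOfShape_le (WithTop ι) _ ⟨?_⟩
    exact
      { F := F
        isoBot := Iso.refl _
        isWellOrderContinuous := inferInstance
        incl := { app j := F.map (homOfLE le_top)
                  naturality j k φ := by
                    dsimp only [Functor.const_obj_obj, Functor.const_obj_map]
                    rw [← F.map_comp, Category.comp_id]; rfl }
        isColimit :=
          { desc s := s.ι.app ⊤
            fac s j := s.w (homOfLE le_top)
            uniq s l hl := by
              rw [← hl ⊤]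
              exact ((F.map_id _ =≫ l).trans (Category.id_comp _)).symm }
        fac := by simp
        map_mem j hj := by
          cases j with
          | top => exact (hj isMax_top).elim
          | coe i =>
            refine MorphismProperty.of_isPushout (isPushout_sigmaMap
              (fun k ↦ (G k).map (homOfLE (Order.le_succ (i : WithTop ι)))) i fun k hk ↦ ?_) ?_
            · refine stepFunctor_map_isIso _ _ _ ?_
              rcases lt_or_gt_of_ne hk with h | h
              · exact Or.inl (WithTop.coe_lt_coe.2 h)
              · exact Or.inr (not_lt.2 (Order.succ_le_of_lt (WithTop.coe_lt_coe.2 h)))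
            · obtain ⟨e⟩ := nonempty_arrow_stepFunctor_map_iso (i : WithTop ι) (f i)
                (homOfLE (Order.le_succ (i : WithTop ι))) (lt_irrefl _)
                (Order.lt_succ_of_not_isMax hj)
              exact (C.arrow_mk_iso_iff e).2 (hf i) }
  let e (i : ι) := (nonempty_arrow_stepFunctor_map_iso (WithTop.some i) (f i)
    (homOfLE bot_le : ⊥ ⟶ ⊤) not_lt_bot (WithTop.coe_lt_top i)).some
  exact (C.arrow_mk_iso_iff (nonempty_arrow_sigmaMap_iso _ _ e).some).1 hF

lemma IsSaturatedClass.isStableUnderCoproducts [HasCoproducts.{v} M]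
    {C : MorphismProperty M} (hC : IsSaturatedClass C) :
    MorphismProperty.IsStableUnderCoproducts.{v} C where
  isStableUnderCoproductsOfShape ι := by
    have := hC.retracts
    exact MorphismProperty.IsStableUnderCoproductsOfShape.mk _ _
      fun _ _ _ _ f hf ↦ sigmaMap_mem_of_isSaturatedClass hC f hf

end Coproducts

/-! ### Sequences and sequential finiteness -/

section Sequences

variable {M : Type u} [Category.{v} M] {C : MorphismProperty M}

lemma IsSequenceIn.map_mem [HasColimits M] (hC : IsSaturatedClass C) {L : Type v} [LinearOrder L]
    [SuccOrder L] [OrderBot L] [WellFoundedLT L] [NoMaxOrder L] {F : L ⥤ M}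
    (hF : IsSequenceIn C F) {j k : L} (φ : j ⟶ k) : C (F.map φ) := by
  have := hC.retracts
  have := hC.transfiniteCompositions
  have := hF.continuous
  let h : C.TransfiniteCompositionOfShape L (colimit.ι F ⊥) :=
    { F := F
      isoBot := Iso.refl _
      isWellOrderContinuous := inferInstance
      incl := (colimit.cocone F).ι
      isColimit := colimit.isColimit F
      fac := by simp
      map_mem j _ := hF.map_succ j }
  exact h.mem_map φ

lemma IsSequentiallyFiniteRelativeTo.preservesColimit {X : M}
    (hX : IsSequentiallyFiniteRelativeTo C X) {L : Type v} [LinearOrder L]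
    [SuccOrder L] [OrderBot L] [WellFoundedLT L] [NoMaxOrder L] {F : L ⥤ M}
    (hF : IsSequenceIn C F) : PreservesColimit F (coyoneda.obj (op X)) := by
  obtain ⟨k, hk⟩ := hX
  refine hk L (fun s hs ↦ ?_) F hF
  have : s.Finite := Cardinal.lt_aleph0_iff_set_finite.1 (hs.trans_lt (Cardinal.natCast_lt_aleph0))
  exact this.bddAbove

lemma IsFiniteRelativeTo.isSequentiallyFiniteRelativeTo [HasColimits M] (hC : IsSaturatedClass C)
    {X : M} (hX : IsFiniteRelativeTo C X) : IsSequentiallyFiniteRelativeTo C X :=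
  ⟨0, fun L _ _ _ _ _ _ F hF ↦ hX L F fun _ _ φ ↦ hF.map_mem hC φ⟩

end Sequences

/-! ### The small object argument for `J` -/

section SmallObject

variable {M : Type u} [Category.{v} M] [HasColimits M] {J C : MorphismProperty M}

attribute [local instance] Cardinal.fact_isRegular_aleph0 Cardinal.orderBotAleph0OrdToType

instance : NoMaxOrder Cardinal.aleph0.{v}.ord.ToType := Cardinal.noMaxOrder le_rfl

/-- Sequences of length $\omega$ suffice: each stage is a pushout of a coproduct of maps in `J`,
hence lies in `C`, relative to which the domains are finite. -/
lemma isCardinalForSmallObjectArgument_aleph0 [MorphismProperty.IsSmall.{v} J]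
    (hC : IsSaturatedClass C) (hJC : J ≤ C)
    (hJ : ∀ ⦃A B : M⦄ (j : A ⟶ B), J j → IsSequentiallyFiniteRelativeTo C A) :
    J.IsCardinalForSmallObjectArgument Cardinal.aleph0.{v} where
  preservesColimit {A B X Y} i hi f hf := by
    have := hC.pushouts
    have := hC.isStableUnderCoproducts
    refine (hJ i hi).preservesColimit (F := hf.F) ⟨hf.isWellOrderContinuous, fun j ↦ ?_⟩
    have := (hf.transfiniteCompositionOfShape).map_mem j (not_isMax j)
    refine (?_ : (MorphismProperty.coproducts.{v} (MorphismProperty.ofHoms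
      J.homFamily)).pushouts ≤ C) _ this
    rw [MorphismProperty.ofHoms_homFamily, MorphismProperty.pushouts_le_iff,
      MorphismProperty.coproducts_le_iff]
    exact hJC

lemma llp_rlp_le_of_isSaturatedClass [MorphismProperty.IsSmall.{v} J]
    (hC : IsSaturatedClass C) (hJC : J ≤ C)
    (hJ : ∀ ⦃A B : M⦄ (j : A ⟶ B), J j → IsSequentiallyFiniteRelativeTo C A) :
    J.rlp.llp ≤ C := by
  have := isCardinalForSmallObjectArgument_aleph0 hC hJC hJ
  have := hC.retracts
  have := hC.pushouts
  have := hC.isStableUnderCoproducts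
  have := hC.transfiniteCompositions
  rw [SmallObject.llp_rlp_of_isCardinalForSmallObjectArgument J Cardinal.aleph0.{v},
    MorphismProperty.retracts_le_iff, MorphismProperty.transfiniteCompositions_le_iff,
    MorphismProperty.pushouts_le_iff, MorphismProperty.coproducts_le_iff]
  exact hJC

end SmallObject

/-! ### Factorization of maps of diagrams -/

section FreeMaps

variable {M : Type u} [Category.{v} M] [HasColimits M] {D : Type v} [SmallCategory D]

/-- The natural transformations obtained from the maps in `J` by applying the left adjoints of the
evaluation functors at the objects in `N`. -/
noncomputable def freeMaps (J : MorphismProperty M) (N : Set D) : MorphismProperty (D ⥤ M) :=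
  MorphismProperty.ofHoms
    fun x : N × J.toSet ↦ (evaluationLeftAdjoint M x.1.1).map x.2.1.hom

variable {J : MorphismProperty M} {N : Set D}

lemma freeMaps_map {c : D} (hc : c ∈ N) {A B : M} {j : A ⟶ B} (hj : J j) :
    freeMaps J N ((evaluationLeftAdjoint M c).map j) :=
  ⟨(⟨⟨c, hc⟩, ⟨Arrow.mk j, hj⟩⟩ : N × J.toSet)⟩

lemma freeMaps_rlp_iff {X Y : D ⥤ M} (q : X ⟶ Y) :
    (freeMaps J N).rlp q ↔ ∀ c ∈ N, J.rlp (q.app c) := by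
  constructor
  · intro h c hc A B j hj
    exact ((evaluationAdjunctionRight M c).hasLiftingProperty_iff j q).1
      (h _ (freeMaps_map hc hj))
  · rintro h _ _ _ ⟨⟨⟨c, hc⟩, ⟨j, hj⟩⟩⟩
    exact ((evaluationAdjunctionRight M c).hasLiftingProperty_iff j.hom q).2 (h c hc _ hj)

instance [MorphismProperty.IsSmall.{v} J] : MorphismProperty.IsSmall.{v} (freeMaps J N) := by
  unfold freeMaps
  infer_instance

variable {X Z : D ⥤ M} {φ : X ⟶ Z}

/-- Evaluation at $d$ has the right adjoint $E\mapsto(c\mapsto\prod_{c\to d}E)$, and a product of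
copies of $r$ still lifts against `J`. -/
lemma app_mem_llp_rlp [HasLimits M] (hφ : (freeMaps J N).rlp.llp φ) (d : D) :
    J.rlp.llp (φ.app d) := by
  intro E B r hr
  refine ((evaluationAdjunctionLeft M d).hasLiftingProperty_iff φ r).2 (hφ _ ?_)
  rw [freeMaps_rlp_iff]
  intro c _ A B j hj
  have := hr j hj
  exact inferInstanceAs (HasLiftingProperty j (Limits.Pi.map fun _ : c ⟶ d ↦ r))

lemma colimMap_mem_llp_rlp (hφ : (freeMaps J N).rlp.llp φ) : J.rlp.llp (colimMap φ) := by
  intro E B r hr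
  refine (colimConstAdj.hasLiftingProperty_iff φ r).2 (hφ _ ?_)
  rw [freeMaps_rlp_iff]
  intro c _
  exact hr

section

attribute [local instance] Cardinal.fact_isRegular_aleph0 Cardinal.orderBotAleph0OrdToType

lemma preservesColimit_coyoneda_evaluationLeftAdjoint {L : Type v} [SmallCategory L] (c : D)
    (A : M) (F : L ⥤ D ⥤ M)
    [PreservesColimit (F ⋙ (evaluation D M).obj c) (coyoneda.obj (op A))] :
    PreservesColimit F (coyoneda.obj (op ((evaluationLeftAdjoint M c).obj A))) := by
  let e : (evaluation D M).obj c ⋙ coyoneda.obj (op A) ≅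
      coyoneda.obj (op ((evaluationLeftAdjoint M c).obj A)) :=
    ((evaluationAdjunctionRight M c).compCoyonedaIso.app (op A)).symm
  exact preservesColimit_of_natIso F e

/-- Maps out of the free diagram on $A$ at $c$ are maps from $A$ to the value at $c$. Evaluating a
stage of the construction at $c$ gives a map in `J.rlp.llp`, hence in `C`, so finiteness of $A$
suffices. -/
lemma exists_factorization_freeMaps [HasLimits M] [MorphismProperty.IsSmall.{v} J]
    {C : MorphismProperty M} (hC : IsSaturatedClass C) (hJC : J ≤ C)
    (hJ : ∀ ⦃A B : M⦄ (j : A ⟶ B), J j → IsSequentiallyFiniteRelativeTo C A)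
    (N : Set D) {X Y : D ⥤ M} (p : X ⟶ Y) :
    ∃ (Z : D ⥤ M) (φ : X ⟶ Z) (q : Z ⟶ Y), φ ≫ q = p ∧
      (freeMaps J N).rlp.llp φ ∧ ∀ c ∈ N, J.rlp (q.app c) := by
  have : (freeMaps J N).IsCardinalForSmallObjectArgument Cardinal.aleph0.{v} :=
    { preservesColimit := by
        rintro _ _ _ _ _ ⟨⟨⟨c, hc⟩, ⟨j, hj⟩⟩⟩ f hf
        have := hf.isWellOrderContinuous
        have : PreservesColimit (hf.F ⋙ (evaluation D M).obj c) (coyoneda.obj (op j.left)) := by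
          refine (hJ j.hom hj).preservesColimit ⟨inferInstance, fun k ↦ ?_⟩
          refine llp_rlp_le_of_isSaturatedClass hC hJC hJ _
            (app_mem_llp_rlp (N := N) (φ := hf.F.map (homOfLE (Order.le_succ k))) ?_ c)
          have := (hf.transfiniteCompositionOfShape).map_mem k (not_isMax k)
          refine (?_ : (MorphismProperty.coproducts.{v} (MorphismProperty.ofHoms
            (freeMaps J N).homFamily)).pushouts ≤ (freeMaps J N).rlp.llp) _ this
          rw [MorphismProperty.ofHoms_homFamily, MorphismProperty.pushouts_le_iff,
            MorphismProperty.coproducts_le_iff]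
          exact MorphismProperty.le_llp_rlp _
        exact preservesColimit_coyoneda_evaluationLeftAdjoint c j.left hf.F }
  exact ⟨_, _, _, SmallObject.ιObj_πObj (freeMaps J N) Cardinal.aleph0.{v} p,
    SmallObject.llp_rlp_ιObj _ _ _,
    (freeMaps_rlp_iff _).1 (SmallObject.rlp_πObj _ _ _)⟩

end

end FreeMaps

/-! ### Corner maps and transition maps -/

section Corner

variable {M : Type u} [Category.{v} M] {D : Type v}

/-- The lifting property of the map from the pushout of `φ.app d` and `X.map e` to `Z.obj d'`
with respect to `r`. -/
def CornerLift [Category.{v} D] {X Z : D ⥤ M} (φ : X ⟶ Z) {d d' : D} (e : d ⟶ d') {E B : M}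
    (r : E ⟶ B) : Prop :=
  ∀ (a : X.obj d' ⟶ E) (b : Z.obj d ⟶ E) (c : Z.obj d' ⟶ B), X.map e ≫ a = φ.app d ≫ b →
    b ≫ r = Z.map e ≫ c → a ≫ r = φ.app d' ≫ c →
    ∃ l : Z.obj d' ⟶ E, φ.app d' ≫ l = a ∧ Z.map e ≫ l = b ∧ l ≫ r = c

/-- In this form the condition transposes along right Kan extension from $[1]$ to a lifting property
of `φ` itself, so it needs checking only on generators. -/
lemma cornerLift_iff [Category.{v} D] {X Z : D ⥤ M} (φ : X ⟶ Z) {d d' : D} (e : d ⟶ d')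
    {E B : M} (r : E ⟶ B) :
    HasLiftingProperty
      (((Functor.whiskeringLeft _ _ M).obj (ComposableArrows.mk₁ e)).map φ)
      (ComposableArrows.homMk₁ (𝟙 E) r rfl :
        ComposableArrows.mk₁ (𝟙 E) ⟶ ComposableArrows.mk₁ r) ↔ CornerLift φ e r := by
  constructor
  · intro h a b c h₁ h₂ h₃
    let F : ComposableArrows M 1 := ComposableArrows.mk₁ e ⋙ X
    let G : ComposableArrows M 1 := ComposableArrows.mk₁ e ⋙ Z
    let f : F ⟶ ComposableArrows.mk₁ (𝟙 E) :=
      ComposableArrows.homMk₁ (X.map e ≫ a) a (Category.comp_id _).symm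
    let g : G ⟶ ComposableArrows.mk₁ r :=
      ComposableArrows.homMk₁ b c h₂.symm
    have sq : CommSq f (((Functor.whiskeringLeft _ _ M).obj (ComposableArrows.mk₁ e)).map φ)
      (ComposableArrows.homMk₁ (𝟙 E) r rfl :
        ComposableArrows.mk₁ (𝟙 E) ⟶ ComposableArrows.mk₁ r) g :=
      ⟨ComposableArrows.hom_ext₁ ((Category.comp_id _).trans h₁) h₃⟩
    refine ⟨sq.lift.app 1, ?_, ?_, ?_⟩
    · exact congr_app sq.fac_left 1
    · have h₄ := congr_app sq.fac_right 0
      have h₅ := sq.lift.naturality (homOfLE (Fin.zero_le 1) : (0 : Fin 2) ⟶ 1)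
      refine (h₅.trans ?_)
      refine Eq.trans ?_ h₄
      rfl
    · exact congr_app sq.fac_right 1
  · intro h
    refine ⟨fun {f g} sq ↦ ?_⟩
    obtain ⟨l, h₁, h₂, h₃⟩ := h (f.app 1) (g.app 0) (g.app 1)
      ((f.naturality (homOfLE (Fin.zero_le 1) : (0 : Fin 2) ⟶ 1)).trans (congr_app sq.w 0))
      (g.naturality (homOfLE (Fin.zero_le 1) : (0 : Fin 2) ⟶ 1)).symm
      (congr_app sq.w 1)
    let G : ComposableArrows M 1 := ComposableArrows.mk₁ e ⋙ Z
    let l' : G ⟶ ComposableArrows.mk₁ (𝟙 E) :=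
      ComposableArrows.homMk₁ (Z.map e ≫ l) l (Category.comp_id _).symm
    refine ⟨⟨l', ?_, ?_⟩⟩
    · refine ComposableArrows.hom_ext₁ ?_ h₁
      refine ((congr_arg (φ.app d ≫ ·) h₂).trans ?_)
      have := congr_app sq.w 0
      exact this.symm.trans (Category.comp_id _)
    · exact ComposableArrows.hom_ext₁ ((Category.comp_id _).trans h₂) h₃

variable [HasColimits M] {J : MorphismProperty M} {N : Set D}

lemma cornerLift_evaluationLeftAdjoint_map [Preorder D] (c : D) {A A' : M} {j : A ⟶ A'}
    {E B : M} {r : E ⟶ B} [HasLiftingProperty j r] {d d' : D} (e : d ⟶ d') :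
    CornerLift ((evaluationLeftAdjoint M c).map j) e r := by
  intro a b w h₁ h₂ h₃
  let L := evaluationLeftAdjoint M c
  let i (A : M) {d : D} (g : c ⟶ d) : A ⟶ (L.obj A).obj d := Sigma.ι (fun _ : c ⟶ d ↦ A) g
  have hi {A T : M} {d : D} {x y : (L.obj A).obj d ⟶ T} (h : ∀ g : c ⟶ d, i A g ≫ x = i A g ≫ y) :
      x = y := Sigma.hom_ext (f := fun _ : c ⟶ d ↦ A) x y h
  have hd {A T : M} {d : D} (t : ∀ g : c ⟶ d, A ⟶ T) :
      ∃ x : (L.obj A).obj d ⟶ T, ∀ g, i A g ≫ x = t g :=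
    ⟨Sigma.desc (f := fun _ : c ⟶ d ↦ A) t, fun g ↦ Sigma.ι_desc (f := fun _ : c ⟶ d ↦ A) t g⟩
  have hm (A : M) (g : c ⟶ d) : i A g ≫ (L.obj A).map e = i A (g ≫ e) :=
    Sigma.ι_desc (f := fun _ : c ⟶ d ↦ A) _ g
  have hj {d : D} (g : c ⟶ d) : i A g ≫ (L.map j).app d = j ≫ i A' g :=
    Sigma.ι_desc (f := fun _ : c ⟶ d ↦ A) _ g
  change (L.obj A).map e ≫ a = (L.map j).app d ≫ b at h₁
  change b ≫ r = (L.obj A').map e ≫ w at h₂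
  change a ≫ r = (L.map j).app d' ≫ w at h₃
  change ∃ l : (L.obj A').obj d' ⟶ E,
    (L.map j).app d' ≫ l = a ∧ (L.obj A').map e ≫ l = b ∧ l ≫ r = w
  have key (g : c ⟶ d') : ∃ t : A' ⟶ E, j ≫ t = i A g ≫ a ∧
      (∀ h : c ⟶ d, t = i A' h ≫ b) ∧ t ≫ r = i A' g ≫ w := by
    -- If $c\le d$, the summand is already present at $d$, and `b` dictates the lift. Otherwise `b`
    -- imposes nothing on it, and `j` lifts against `r`.
    by_cases h : Nonempty (c ⟶ d)
    · obtain ⟨h⟩ := h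
      obtain rfl : g = h ≫ e := Subsingleton.elim _ _
      refine ⟨i A' h ≫ b, ?_, fun h' ↦ by rw [Subsingleton.elim h h'], ?_⟩
      · rw [← reassoc_of% (hj h), ← h₁, reassoc_of% (hm A h)]
      · rw [Category.assoc, h₂, reassoc_of% (hm A' h)]
    · have sq : CommSq (i A g ≫ a) j r (i A' g ≫ w) :=
        ⟨by rw [Category.assoc, h₃, reassoc_of% (hj g)]⟩
      exact ⟨sq.lift, sq.fac_left, fun h' ↦ (h ⟨h'⟩).elim, sq.fac_right⟩
  choose t ht₁ ht₂ ht₃ using key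
  obtain ⟨l, hl⟩ := hd t
  refine ⟨l, hi fun g ↦ ?_, hi fun g ↦ ?_, hi fun g ↦ ?_⟩
  · rw [reassoc_of% (hj g), hl, ht₁]
  · rw [reassoc_of% (hm A' g), hl, ht₂ _ g]
  · rw [reassoc_of% (hl g), ht₃]

lemma cornerLift_of_llp_rlp [HasLimits M] [Preorder D] {X Z : D ⥤ M} {φ : X ⟶ Z}
    (hφ : (freeMaps J N).rlp.llp φ) {d d' : D} (e : d ⟶ d') {E B : M} {r : E ⟶ B}
    (hr : J.rlp r) : CornerLift φ e r := by
  rw [← cornerLift_iff]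
  have : HasLimitsOfSize.{0, v} M := hasLimitsOfSizeOfUnivLE.{v, v} M
  refine (((ComposableArrows.mk₁ e).ranAdjunction M).hasLiftingProperty_iff _ _).2 (hφ _ ?_)
  rintro _ _ _ ⟨⟨⟨c, hc⟩, ⟨j, hj⟩⟩⟩
  refine (((ComposableArrows.mk₁ e).ranAdjunction M).hasLiftingProperty_iff _ _).1 ?_
  rw [cornerLift_iff]
  have := hr _ hj
  exact cornerLift_evaluationLeftAdjoint_map c e

/-- The map $Z_d\to Z_{d'}$ is a pushout of $X_d\to X_{d'}$ followed by the corner map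
$X_{d'}\sqcup_{X_d}Z_d\to Z_{d'}$, which lies in `J.rlp.llp`. -/
lemma map_mem_of_llp_rlp [HasLimits M] [Preorder D] {C : MorphismProperty M} (hC : IsSaturatedClass C)
    (hJC : J.rlp.llp ≤ C) {X Z : D ⥤ M} {φ : X ⟶ Z}
    (hφ : (freeMaps J N).rlp.llp φ) {d d' : D} (e : d ⟶ d') (he : C (X.map e)) :
    C (Z.map e) := by
  have := hC.pushouts
  have := hC.transfiniteCompositions
  have sq := IsPushout.of_hasPushout (φ.app d) (X.map e)
  have hφe := (φ.naturality e).symm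
  rw [← sq.inl_desc _ _ hφe]
  refine C.comp_mem _ _ (C.of_isPushout sq he) (hJC _ ?_)
  intro E B r hr
  refine ⟨fun {f g} sq' ↦ ?_⟩
  have h := sq'.w
  obtain ⟨l, h₁, h₂, h₃⟩ := cornerLift_of_llp_rlp hφ e hr (pushout.inr _ _ ≫ f)
    (pushout.inl _ _ ≫ f) g (by rw [pushout.condition_assoc])
    (by rw [Category.assoc, h, sq.inl_desc_assoc]) (by rw [Category.assoc, h, sq.inr_desc_assoc])
  exact ⟨⟨l, sq.hom_ext (by rw [sq.inl_desc_assoc, h₂]) (by rw [sq.inr_desc_assoc, h₁]), h₃⟩⟩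

end Corner

/-! ### Diagrams extended from a subset of indices -/

section KanExtension

variable {M : Type u} [Category.{v} M] {D : Type v} [Preorder D] (N : Set D)

/-- The functor `F` is the left Kan extension of its restriction to the elements in `N`. -/
def IsExtendedFrom (F : D ⥤ M) : Prop :=
  ∀ (m : D) (T : M) (t : ∀ j ∈ N, j ≤ m → (F.obj j ⟶ T)),
    (∀ (j k : D) (hj : j ∈ N) (hk : k ∈ N) (hkm : k ≤ m) (h : j ≤ k),
      F.map (homOfLE h) ≫ t k hk hkm = t j hj (h.trans hkm)) →
    ∃! l : F.obj m ⟶ T, ∀ (j : D) (hj : j ∈ N) (hjm : j ≤ m), F.map (homOfLE hjm) ≫ l = t j hj hjm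

/-- The inclusion functor of a subset of a preorder. -/
abbrev inclusionFunctor : N ⥤ D := (Subtype.mono_coe (· ∈ N)).functor

instance : (inclusionFunctor N).Full where
  map_surjective f := ⟨homOfLE (leOfHom f), rfl⟩

instance : (inclusionFunctor N).Faithful where

variable {N} in
lemma isExtendedFrom_iff_isPointwiseLeftKanExtension (F : D ⥤ M) :
    IsExtendedFrom N F ↔ Nonempty (Functor.LeftExtension.mk F
      (𝟙 (inclusionFunctor N ⋙ F))).IsPointwiseLeftKanExtension := by
  constructor
  · intro h
    refine ⟨fun m ↦ ?_⟩
    choose d hd hd' using fun s : Cocone (CostructuredArrow.proj (inclusionFunctor N) m ⋙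
        inclusionFunctor N ⋙ F) ↦ h m s.pt
          (fun j hj hjm ↦ s.ι.app (CostructuredArrow.mk (Y := (⟨j, hj⟩ : N)) (homOfLE hjm)))
          (fun j k hj hk hkm h ↦ s.w (CostructuredArrow.homMk (homOfLE h) :
            CostructuredArrow.mk (S := inclusionFunctor N) (Y := (⟨j, hj⟩ : N))
              (homOfLE (h.trans hkm) : j ⟶ m) ⟶
            CostructuredArrow.mk (Y := (⟨k, hk⟩ : N)) (homOfLE hkm : k ⟶ m)))
    exact {
      desc s := d s
      fac s j := (congr_arg (· ≫ d s) (Category.id_comp (F.map j.hom))).trans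
        (hd s j.left.1 j.left.2 (leOfHom j.hom))
      uniq s l hl := hd' s l fun j hj hjm ↦
        (congr_arg (· ≫ l) (Category.id_comp (F.map (homOfLE hjm)))).symm.trans
          (hl (CostructuredArrow.mk (Y := (⟨j, hj⟩ : N)) (homOfLE hjm))) }
  · rintro ⟨h⟩ m T t ht
    let s : Cocone (CostructuredArrow.proj (inclusionFunctor N) m ⋙
        inclusionFunctor N ⋙ F) :=
      { pt := T
        ι := { app j := t j.left.1 j.left.2 (leOfHom j.hom)
               naturality j k φ := (ht _ _ j.left.2 k.left.2 (leOfHom k.hom)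
                (leOfHom φ.left)).trans (Category.comp_id _).symm } }
    refine ⟨(h m).desc s, fun j hj hjm ↦ ?_, fun l hl ↦ (h m).uniq s l fun j ↦ ?_⟩
    · exact (congr_arg (· ≫ (h m).desc s) (Category.id_comp (F.map (homOfLE hjm)))).symm.trans
        ((h m).fac s (CostructuredArrow.mk (Y := (⟨j, hj⟩ : N)) (homOfLE hjm)))
    · exact (congr_arg (· ≫ l) (Category.id_comp (F.map j.hom))).trans
        (hl j.left.1 j.left.2 (leOfHom j.hom))

variable [HasColimits M]

variable {N} in
lemma isExtendedFrom_iff_isIso_counit (F : D ⥤ M) :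
    IsExtendedFrom N F ↔ IsIso (((inclusionFunctor N).lanAdjunction M).counit.app F) := by
  rw [isExtendedFrom_iff_isPointwiseLeftKanExtension, Functor.isIso_lanAdjunction_counit_app_iff]
  constructor
  · rintro ⟨h⟩
    exact h.isLeftKanExtension
  · intro h
    exact ⟨Functor.isPointwiseLeftKanExtensionOfIsLeftKanExtension F
      (𝟙 (inclusionFunctor N ⋙ F))⟩

/-- The counit at $Z$ from the left Kan extension of $Z|_N$ is invertible on `N`, so `φ` lifts
against it. This produces a section, which is then shown to be an inverse. -/
lemma IsExtendedFrom.of_llp_rlp {J : MorphismProperty M} {X Z : D ⥤ M} {φ : X ⟶ Z}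
    (hφ : (freeMaps J N).rlp.llp φ) (hX : IsExtendedFrom N X) : IsExtendedFrom N Z := by
  rw [isExtendedFrom_iff_isIso_counit] at hX ⊢
  let adj := (inclusionFunctor N).lanAdjunction M
  let R := (Functor.whiskeringLeft _ _ M).obj (inclusionFunctor N)
  have hu (Y : N ⥤ M) : IsIso (adj.unit.app Y) := by
    dsimp only [adj]
    rw [Functor.lanAdjunction_unit]
    infer_instance
  have hR (Y : D ⥤ M) : IsIso (R.map (adj.counit.app Y)) :=
    IsIso.of_isIso_fac_left (adj.right_triangle_components Y)
  have hε : (freeMaps J N).rlp (adj.counit.app Z) := by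
    rw [freeMaps_rlp_iff]
    intro c hc
    have : IsIso ((adj.counit.app Z).app c) :=
      inferInstanceAs (IsIso ((R.map (adj.counit.app Z)).app ⟨c, hc⟩))
    intro _ _ _ _
    infer_instance
  have := hφ _ hε
  have sq : CommSq (inv (adj.counit.app X) ≫ (inclusionFunctor N).lan.map (R.map φ)) φ
      (adj.counit.app Z) (𝟙 Z) := ⟨by
    have h : (inclusionFunctor N).lan.map (R.map φ) ≫ adj.counit.app Z =
      adj.counit.app X ≫ φ := adj.counit.naturality φ
    rw [Category.assoc, h, IsIso.inv_hom_id_assoc, Category.comp_id]⟩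
  have h₁ : sq.lift ≫ adj.counit.app Z = 𝟙 Z := sq.fac_right
  have h₂ : adj.counit.app Z ≫ sq.lift = 𝟙 _ := by
    -- An endomorphism of the left Kan extension is determined by its restriction to `N`, where the
    -- counit is invertible.
    apply (adj.homEquiv _ _).injective
    have := hR Z
    have h₃ : R.map (sq.lift) = adj.unit.app (R.obj Z) := by
      rw [← cancel_mono (R.map (adj.counit.app Z)), adj.right_triangle_components,
        ← R.map_comp, h₁, R.map_id]
    have h₄ : adj.unit.app (R.obj Z) ≫ R.map (adj.counit.app Z) = 𝟙 _ :=
      adj.right_triangle_components Z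
    rw [adj.homEquiv_unit, adj.homEquiv_unit, R.map_comp, h₃]
    exact ((reassoc_of% h₄) _).trans
      ((Category.comp_id _).symm.trans (adj.unit.app (R.obj Z) ≫= (R.map_id _).symm))
  exact ⟨sq.lift, h₂, h₁⟩

end KanExtension

/-! ### Continuity as extension from non-limit indices -/

section Limit

variable {M : Type u} [Category.{v} M] {L : Type v} [LinearOrder L] [SuccOrder L] [NoMaxOrder L]

/-- Successors are cofinal below a limit, while a non-limit $m$ is the greatest element of $N_{\le
m}$. A minimal element is not an `IsSuccLimit`, so it belongs to `N` and its value is unconstrained.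
-/
lemma isExtendedFrom_iff_isWellOrderContinuous (F : L ⥤ M) :
    IsExtendedFrom {j | ¬ Order.IsSuccLimit j} F ↔ F.IsWellOrderContinuous := by
  rw [isWellOrderContinuous_iff]
  have hmap {i j k : L} (h : i ≤ j) (h' : j ≤ k) {T : M} (l : F.obj k ⟶ T) :
      F.map (homOfLE (h.trans h')) ≫ l = F.map (homOfLE h) ≫ F.map (homOfLE h') ≫ l := by
    rw [← Category.assoc, ← F.map_comp]; rfl
  constructor
  · intro h m hm T t ht
    have hne {j : L} (hj : ¬ Order.IsSuccLimit j) (hjm : j ≤ m) : j < m :=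
      lt_of_le_of_ne hjm (by rintro rfl; exact hj hm)
    obtain ⟨l, hl, hl'⟩ := h m T (fun j hj hjm ↦ t j (hne hj hjm))
      (fun j k _ hk hkm hjk ↦ ht j k (hne hk hkm) hjk)
    refine ⟨l, fun j hj ↦ ?_, fun l' h' ↦ hl' l' fun j hj hjm ↦ h' j (hne hj hjm)⟩
    have hs := hm.succ_lt hj
    rw [hmap (Order.le_succ j) hs.le, hl _ (Order.not_isSuccLimit_succ j), ht]
  · intro h m T t ht
    by_cases hm : Order.IsSuccLimit m
    · have hs (j : L) : ¬ Order.IsSuccLimit (Order.succ j) := Order.not_isSuccLimit_succ j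
      obtain ⟨l, hl, hl'⟩ := h m hm T
        (fun j hj ↦ F.map (homOfLE (Order.le_succ j)) ≫ t _ (hs j) (hm.succ_lt hj).le)
        (fun j k hk hjk ↦ by
          rw [← hmap hjk (Order.le_succ k), hmap (Order.le_succ j) (Order.succ_le_succ hjk),
            ht _ _ (hs j) (hs k)])
      refine ⟨l, fun j hj hjm ↦ ?_, fun l' h' ↦ hl' l' fun j hj ↦ ?_⟩
      · have hjm' : j < m := lt_of_le_of_ne hjm (by rintro rfl; exact hj hm)
        rw [hl j hjm', ht _ _ hj (hs j)]
      · rw [hmap (Order.le_succ j) (hm.succ_lt hj).le, h' _ (hs j)]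
    · refine ⟨t m hm le_rfl, fun j hj hjm ↦ ht j m hj hm le_rfl hjm, fun l hl ↦ ?_⟩
      rw [← hl m hm le_rfl]
      exact ((F.map_id m =≫ l).trans (Category.id_comp l)).symm

end Limit

/-! ### Finiteness of tensors -/

section Tensor

variable {M : Type u} [Category.{v} M] [SimplicialCategory M]

namespace SimplicialTensor

variable {A : M} {S : SSet.{v}} (t : SimplicialTensor A S)

/-- The isomorphism `Map(A ⊗ S, Y) ⟶ Map(S, Map(A, Y))`. -/
noncomputable abbrev adjMap (Y : M) :=
  MonoidalClosed.curry (t.unit ▷ SimplicialCategory.sHom t.obj Y ≫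
    SimplicialCategory.sHomComp A t.obj Y)

lemma eHomEquiv_comp_adjMap {Y : M} (f : t.obj ⟶ Y) :
    eHomEquiv SSet.{v} f ≫ t.adjMap Y = MonoidalClosed.curry' (t.unit ≫ sHomPost A f) := by
  rw [adjMap, ← MonoidalClosed.curry_natural_left, MonoidalClosed.curry']
  congr 1

/-- The bijection between morphisms `A ⊗ S ⟶ Y` and morphisms `S ⟶ Map(A, Y)`. -/
noncomputable def homEquiv (Y : M) : (t.obj ⟶ Y) ≃ (S ⟶ SimplicialCategory.sHom A Y) where
  toFun f := t.unit ≫ sHomPost A f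
  invFun g := t.desc g
  left_inv f := by
    dsimp [desc]
    rw [← eHomEquiv_comp_adjMap, Category.assoc, IsIso.hom_inv_id, Category.comp_id,
      Equiv.symm_apply_apply]
  right_inv g := by
    have h := t.eHomEquiv_comp_adjMap (t.desc g)
    refine (MonoidalClosed.curry'_injective (h.symm.trans ?_))
    rw [desc, Equiv.apply_symm_apply, Category.assoc, IsIso.inv_hom_id, Category.comp_id]

/-- The functor corepresented by `A ⊗ S`. -/
noncomputable def coyonedaIso :
    eCoyoneda SSet.{v} A ⋙ coyoneda.obj (op S) ≅ coyoneda.obj (op t.obj) :=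
  (NatIso.ofComponents (fun Y ↦ (t.homEquiv Y).toIso) (by
    intro Y Y' f
    ext g
    change t.unit ≫ sHomPost A (g ≫ f) = (t.unit ≫ sHomPost A g) ≫ sHomPost A f
    rw [sHomPost, eHomWhiskerLeft_comp, Category.assoc])).symm

end SimplicialTensor

variable {D : Type v} [SmallCategory D]

/-- The $n$-simplices of $\mathrm{Map}(A,Y)$ are the maps $A\otimes\Delta[n]\to Y$, and colimits of
simplicial sets are computed levelwise. -/
lemma preservesColimit_eCoyoneda (A : M) (F : D ⥤ M)
    (t : ∀ n : ℕ, SimplicialTensor A Δ[n])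
    (ht : ∀ n, PreservesColimit F (coyoneda.obj (op (t n).obj))) :
    PreservesColimit F (eCoyoneda SSet.{v} A) := by
  refine preservesColimit_of_evaluation (K := SimplexCategoryᵒᵖ) _ F fun n ↦ ?_
  have := ht n.unop.len
  let e : coyoneda.obj (op (Δ[n.unop.len] : SSet.{v})) ≅
      (evaluation SimplexCategoryᵒᵖ (Type v)).obj n :=
    NatIso.ofComponents (fun X ↦ SSet.yonedaEquiv.toIso) (by
      intro X Y f
      ext g
      rfl)
  exact preservesColimit_of_natIso F
    ((t n.unop.len).coyonedaIso.symm ≪≫ Functor.isoWhiskerLeft (eCoyoneda SSet.{v} A) e)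

lemma preservesColimit_coyoneda_tensor [IsFiltered D] {A : M} {S : SSet.{v}} [S.Finite]
    (t : SimplicialTensor A S) (F : D ⥤ M) [PreservesColimit F (eCoyoneda SSet.{v} A)] :
    PreservesColimit F (coyoneda.obj (op t.obj)) := by
  have : PreservesColimitsOfShape D (coyoneda.obj (op S)) := by
    infer_instance
  exact preservesColimit_of_natIso F t.coyonedaIso

end Tensor

/-! ### Colimits of colocal equivalences -/

section Main

variable {M : Type u} [Category.{v} M]

lemma IsModelStructure.hasTwoOutOfThreeProperty {W Cof Fib : MorphismProperty M}
    (h : IsModelStructure W Cof Fib) : W.HasTwoOutOfThreeProperty := by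
  obtain ⟨h, rfl, -, -⟩ := h
  exact h.cm2

lemma IsModelStructure.isStableUnderRetracts {W Cof Fib : MorphismProperty M}
    (h : IsModelStructure W Cof Fib) : W.IsStableUnderRetracts := by
  obtain ⟨h, rfl, -, -⟩ := h
  exact h.cm3a

lemma IsModelStructure.llp_le {W Cof Fib : MorphismProperty M}
    (h : IsModelStructure W Cof Fib) : Fib.llp ≤ W := by
  obtain ⟨h, rfl, -, rfl⟩ := h
  exact (fibrations_llp M).trans_le inf_le_right

lemma hasLiftingProperty_colimMap [HasColimits M] {D : Type v} [Preorder D] [IsDirectedOrder D]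
    [Nonempty D] {N : Set D} (hN : ∀ d : D, ∃ c ∈ N, d ≤ c) {Z Y : D ⥤ M} (q : Z ⟶ Y)
    {A B : M} (i : A ⟶ B) [PreservesColimit Z (coyoneda.obj (op A))]
    [PreservesColimit Y (coyoneda.obj (op A))] [PreservesColimit Y (coyoneda.obj (op B))]
    (h : ∀ c ∈ N, HasLiftingProperty i (q.app c)) : HasLiftingProperty i (colimMap q) := by
  refine ⟨fun {f g} sq ↦ ?_⟩
  obtain ⟨d₁, f', hf'⟩ := exists_hom_of_preservesColimit_coyoneda
    (colimit.isColimit Z) f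
  obtain ⟨d₂, g', hg'⟩ := exists_hom_of_preservesColimit_coyoneda
    (colimit.isColimit Y) g
  obtain ⟨d₃, h₁, h₂⟩ := exists_ge_ge d₁ d₂
  change f' ≫ colimit.ι Z d₁ = f at hf'
  change g' ≫ colimit.ι Y d₂ = g at hg'
  have h₃ : (f' ≫ Z.map (homOfLE h₁) ≫ q.app d₃) ≫ (colimit.cocone Y).ι.app d₃ =
      (i ≫ g' ≫ Y.map (homOfLE h₂)) ≫ (colimit.cocone Y).ι.app d₃ := by
    have := sq.w
    rw [← hf', ← hg'] at this
    simpa using this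
  -- The square descended to $d_3$ is known to commute only in the colimit, hence commutes at some
  -- later index; cofinality then moves it into `N`.
  obtain ⟨d₄, φ, hφ⟩ := exists_eq_of_preservesColimit_coyoneda_self
    (colimit.isColimit Y) _ _ h₃
  obtain ⟨c, hc, hdc⟩ := hN d₄
  have := h c hc
  have sq' : CommSq (f' ≫ Z.map (homOfLE h₁) ≫ Z.map φ ≫ Z.map (homOfLE hdc)) i (q.app c)
      (g' ≫ Y.map (homOfLE h₂) ≫ Y.map φ ≫ Y.map (homOfLE hdc)) := ⟨by
    have := hφ =≫ Y.map (homOfLE hdc)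
    simpa using this⟩
  refine ⟨⟨sq'.lift ≫ colimit.ι Z c, ?_, ?_⟩⟩
  · rw [sq'.fac_left_assoc, ← hf']
    simp
  · rw [Category.assoc, ι_colimMap, sq'.fac_right_assoc, ← hg']
    simp

lemma colimMap_mem_of_factorization [HasLimits M] [HasColimits M] {W I J : MorphismProperty M}
    [W.HasTwoOutOfThreeProperty] (hJW : J.rlp.llp ≤ W) (hI : J.rlp ⊓ W = I.rlp)
    {D : Type v} [Preorder D] [IsDirectedOrder D]
    [Nonempty D] {N : Set D} (hN : ∀ d : D, ∃ c ∈ N, d ≤ c) {X Z Y : D ⥤ M}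
    (φ : X ⟶ Z) (q : Z ⟶ Y) (hφ : (freeMaps J N).rlp.llp φ) (hq : ∀ c ∈ N, J.rlp (q.app c))
    (hp : ∀ d, W ((φ ≫ q).app d))
    (hZ : ∀ ⦃A B : M⦄ (i : A ⟶ B), I i → PreservesColimit Z (coyoneda.obj (op A)))
    (hY : ∀ ⦃A B : M⦄ (i : A ⟶ B), I i → PreservesColimit Y (coyoneda.obj (op A)) ∧
      PreservesColimit Y (coyoneda.obj (op B))) :
    W (colimMap (φ ≫ q)) := by
  have hq' : W (colimMap q) := by
    refine (show I.rlp ≤ W from hI ▸ inf_le_right) _ ?_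
    intro A B i hi
    have := hZ i hi
    have := (hY i hi).1
    have := (hY i hi).2
    refine hasLiftingProperty_colimMap hN q i fun c hc ↦ ?_
    have : (J.rlp ⊓ W) (q.app c) :=
      ⟨hq c hc, W.of_precomp (φ.app c) _ (hJW _ (app_mem_llp_rlp hφ c)) (hp c)⟩
    rw [hI] at this
    exact this i hi
  have : colimMap (φ ≫ q) = colimMap φ ≫ colimMap q := by
    ext
    simp
  rw [this]
  exact W.comp_mem _ _ (hJW _ (colimMap_mem_llp_rlp hφ)) hq'

lemma colimMap_mem_of_final [HasColimits M] {W : MorphismProperty M} [W.RespectsIso]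
    {D D' : Type v} [SmallCategory D] [SmallCategory D'] (e : D' ⥤ D) [e.Final] {F G : D ⥤ M}
    (p : F ⟶ G) (hp : W (colimMap (Functor.whiskerLeft e p))) : W (colimMap p) := by
  refine (W.arrow_mk_iso_iff (Arrow.isoMk (Functor.Final.colimitIso e F)
    (Functor.Final.colimitIso e G) ?_)).1 hp
  dsimp
  ext
  simp

section

variable [ModelCategory M] [SimplicialCategory M] [SimplicialModelCategory M]

lemma preservesColimit_of_lambdaSet {K : ObjectProperty M} {J : MorphismProperty M}
    {D : Type v} [SmallCategory D] [IsFiltered D] (F : D ⥤ M)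
    (hK : ∀ (A : M) (n : ℕ), K A → PreservesColimit F (coyoneda.obj (op (sTensor A Δ[n]))))
    (hJ : ∀ ⦃A B : M⦄ (j : A ⟶ B), J j → PreservesColimit F (coyoneda.obj (op A)) ∧
      PreservesColimit F (coyoneda.obj (op B)))
    ⦃A B : M⦄ (i : A ⟶ B) (hi : (LambdaSet K ⊔ J) i) :
    PreservesColimit F (coyoneda.obj (op A)) ∧ PreservesColimit F (coyoneda.obj (op B)) := by
  rcases hi with ⟨⟨⟨A, hA⟩, n⟩⟩ | hi
  · have := preservesColimit_eCoyoneda A F (fun n ↦ SimplicialModelCategory.tensor A Δ[n])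
      fun n ↦ hK A n hA
    exact ⟨preservesColimit_coyoneda_tensor (SimplicialModelCategory.tensor A _) F, hK A n hA⟩
  · exact hJ i hi

end

lemma isSmallRelativeTo_of_isLocallyPresentable [IsLocallyPresentable.{v} M]
    (C : MorphismProperty M) (X : M) : IsSmallRelativeTo C X := by
  have hX : IsPresentable.{v} X := inferInstance
  obtain ⟨κ, _, hκ⟩ := hX.exists_cardinal
  have : IsCardinalPresentable X κ := hκ
  refine ⟨κ, fun L _ _ _ _ _ hL F hF ↦ ?_⟩
  -- Subsets of cardinality at most `κ` are bounded, more than is needed for families of size less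
  -- than `κ`.
  have : IsCardinalFiltered L κ := isCardinalFiltered_preorder _ _ fun ι s hι ↦ by
    obtain ⟨b, hb⟩ := hL (Set.range s) (Cardinal.mk_range_le.trans hι.le)
    exact ⟨b, fun k ↦ hb ⟨k, rfl⟩⟩
  have := preservesColimitsOfShape_of_isCardinalPresentable X κ L
  infer_instance

end Main

end RightBousfield

open RightBousfield
theorem mainTheorem5 {M : Type u} [Category.{v} M] [HasLimits M] [HasColimits M]
    [ModelCategory M] [SimplicialCategory M] [SimplicialModelCategory M]
    (I J : MorphismProperty M)
    (hM : IsCofibrantlyGenerated (weakEquivalences M) (cofibrations M) (fibrations M) I J)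
    (C : MorphismProperty M) (hC : IsSaturatedClass C) (hJC : J ≤ C)
    (K : ObjectProperty M) [ObjectProperty.Small.{v} K] (hK : ∀ A : M, K A → IsCofibrant A)
    (J' : MorphismProperty M)
    (hR : IsCofibrantlyGenerated (colocalEquivalences K) (colocalCofibrations K) (fibrations M)
      (LambdaSet K ⊔ J) J') :
    ((∀ (A : M) (n : ℕ), K A → IsFiniteRelativeTo C (sTensor A Δ[n])) →
      (∀ ⦃A B : M⦄ (j : A ⟶ B), J j → IsFiniteRelativeTo C A ∧ IsFiniteRelativeTo C B) →
      IsClosedUnderFilteredColimitsAlong (colocalEquivalences K) C ∧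
      ((∀ X : M, IsSmallRelativeTo C X) →
        IsCompactlyGeneratedModel (colocalEquivalences K) (colocalCofibrations K) (fibrations M) C)) ∧
    ((∀ (A : M) (n : ℕ), K A → IsSequentiallyFiniteRelativeTo C (sTensor A Δ[n])) →
      (∀ ⦃A B : M⦄ (j : A ⟶ B), J j →
        IsSequentiallyFiniteRelativeTo C A ∧ IsSequentiallyFiniteRelativeTo C B) →
      IsClosedUnderSequentialColimitsAlong (colocalEquivalences K) C) ∧
    (IsLocallyPresentable.{v} M → ∀ X : M, IsSmallRelativeTo C X) := by
  have := hM.isSmall_J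
  have := hR.isModelStructure.hasTwoOutOfThreeProperty
  have := hR.isModelStructure.isStableUnderRetracts
  have hJW : J.rlp.llp ≤ colocalEquivalences K := by
    rw [← hM.fib_eq]
    exact hR.isModelStructure.llp_le
  have hI : J.rlp ⊓ colocalEquivalences K = (LambdaSet K ⊔ J).rlp := by
    rw [← hM.fib_eq]
    exact hR.trivialFib_eq
  refine ⟨fun hKfin hJfin ↦ ?_, fun hKfin hJfin ↦ ?_, fun _ X ↦
    isSmallRelativeTo_of_isLocallyPresentable C X⟩
  · have h : IsClosedUnderFilteredColimitsAlong (colocalEquivalences K) C := by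
      intro D _ _ F G hF hG p hp
      obtain ⟨α, _, _, _, e, _⟩ := IsFiltered.exists_directed D
      refine colimMap_mem_of_final e p ?_
      have hJfin' ⦃A B : M⦄ (j : A ⟶ B) (hj : J j) : IsSequentiallyFiniteRelativeTo C A :=
        (hJfin j hj).1.isSequentiallyFiniteRelativeTo hC
      -- No continuity is needed here, so cells may be attached at every index.
      obtain ⟨Z, φ, q, hφq, hφ, hq⟩ := exists_factorization_freeMaps hC hJC hJfin'
        Set.univ (Functor.whiskerLeft e p)
      have hfin (H : α ⥤ M) (hH : ∀ ⦃a b : α⦄ (g : a ⟶ b), C (H.map g)) ⦃A B : M⦄ (i : A ⟶ B)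
          (hi : (LambdaSet K ⊔ J) i) :=
        preservesColimit_of_lambdaSet H (fun A n hA ↦ hKfin A n hA α H hH)
          (fun A B j hj ↦ ⟨(hJfin j hj).1 α H hH, (hJfin j hj).2 α H hH⟩) i hi
      rw [← hφq]
      refine colimMap_mem_of_factorization hJW hI (N := Set.univ) (fun d ↦ ⟨d, trivial, le_rfl⟩)
        φ q hφ hq (fun d ↦ ?_) (fun A B i hi ↦ (hfin Z (fun a b g ↦ ?_) i hi).1)
        (hfin _ fun a b g ↦ hG _)
      · rw [hφq]
        exact hp _
      · exact map_mem_of_llp_rlp hC (llp_rlp_le_of_isSaturatedClass hC hJC hJfin') hφ g (hF _)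
    exact ⟨h, fun hsmall ↦ ⟨⟨_, _, hR⟩, h, hsmall⟩⟩
  · intro L _ _ _ _ _ F G hF hG p hp
    have hJfin' ⦃A B : M⦄ (j : A ⟶ B) (hj : J j) : IsSequentiallyFiniteRelativeTo C A :=
      (hJfin j hj).1
    -- Non-limit indices are cofinal, as they contain all successors, and restricting the cells to
    -- them keeps $Z$ continuous.
    obtain ⟨Z, φ, q, rfl, hφ, hq⟩ := exists_factorization_freeMaps hC hJC hJfin'
      {j | ¬ Order.IsSuccLimit j} p
    have hZ : IsSequenceIn C Z :=
      { continuous := by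
          rw [← isExtendedFrom_iff_isWellOrderContinuous]
          refine IsExtendedFrom.of_llp_rlp _ hφ ?_
          rw [isExtendedFrom_iff_isWellOrderContinuous]
          exact hF.continuous
        map_succ j := map_mem_of_llp_rlp hC (llp_rlp_le_of_isSaturatedClass hC hJC hJfin') hφ _
          (hF.map_succ j) }
    have hfin (H : L ⥤ M) (hH : IsSequenceIn C H) ⦃A B : M⦄ (i : A ⟶ B)
        (hi : (LambdaSet K ⊔ J) i) :=
      preservesColimit_of_lambdaSet H (fun A n hA ↦ (hKfin A n hA).preservesColimit hH)
        (fun A B j hj ↦ ⟨(hJfin j hj).1.preservesColimit hH,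
          (hJfin j hj).2.preservesColimit hH⟩) i hi
    exact colimMap_mem_of_factorization hJW hI
      (fun d ↦ ⟨Order.succ d, Order.not_isSuccLimit_succ d, Order.le_succ d⟩)
      φ q hφ hq hp (fun A B i hi ↦ (hfin Z hZ i hi).1) (hfin G hG)
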